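/- Let $(M,\operatorname{dist},\mu)$ be a metric probability space. For $n\ge 1$ and $r\ge 0$ let $G_M(n,r)$ be the random graph on $[n]=\{1,\dots,n\}$ obtained by sampling $x_1,\dots,x_n\in M$ independently from $\mu$ and joining distinct $i,j$ when $\operatorname{dist}(x_i,x_j)\le r$. A monotone graph property on $[n]$ is a family of graphs on the labelled vertex set $[n]$ closed under adding edges (not necessarily invariant under relabelling of the vertices); it is nontrivial if it is neither empty nor the family of all graphs on $[n]$. A sequence of positive real numbers $(r_n)$ is a threshold for a sequence $(\mathcal F_n)_{n\ge 2}$ of nontrivial monotone graph properties, $\mathcal F_n$ on $[n]$, if for every sequence of radii $s_n\ge 0$, \[ \mathbb P\bigl(G_M(n,s_n)\in\mathcal F_n\bigr)\to 0\ \text{ whenever } s_n/r_n\to 0, \qquad \mathbb P\bigl(G_M(n,s_n)\in\mathcal F_n\bigr)\to 1\ \text{ whenever } s_n/r_n\to\infty . \] The space $M$ admits thresholds if every sequence $(\mathcal F_n)_{n\ge 2}$ of nontrivial monotone graph properties has a threshold. For every integer $d\ge 1$, the cube $[0,1]^d$, with the Euclidean metric and Lebesgue measure, admits thresholds. -/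

import Mathlib

open Filter MeasureTheory Topology

noncomputable section

namespace RandomGeometricGraph

/-- The geometric graph on the vertex set `Fin n` of a configuration `x` at radius `r`:
distinct `i`, `j` are adjacent when `dist (x i) (x j) ≤ r`. -/
def geomGraph {M : Type*} [MetricSpace M] {n : ℕ} (x : Fin n → M) (r : ℝ) :
    SimpleGraph (Fin n) where
  Adj i j := i ≠ j ∧ dist (x i) (x j) ≤ r
  symm := ⟨fun _ _ h => ⟨h.1.symm, by rw [dist_comm]; exact h.2⟩⟩
  loopless := ⟨fun _ h => h.1 rfl⟩

/-- The probability that the random geometric graph on `n` independent points of law `μ`,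
at radius `r`, belongs to the family `F`. -/
def prob {M : Type*} [MetricSpace M] [MeasurableSpace M] (μ : Measure M) {n : ℕ}
    (F : Set (SimpleGraph (Fin n))) (r : ℝ) : ℝ :=
  (Measure.pi fun _ : Fin n => μ).real {x : Fin n → M | geomGraph x r ∈ F}

/-- A nontrivial monotone property of labelled graphs on `Fin n`: closed under adding edges,
neither empty nor the family of all graphs. -/
structure IsNontrivialMonotone {n : ℕ} (F : Set (SimpleGraph (Fin n))) : Prop where
  monotone : ∀ G ∈ F, ∀ H : SimpleGraph (Fin n), G ≤ H → H ∈ F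
  ne_empty : F ≠ ∅
  ne_univ : F ≠ Set.univ

/-- The sequence of (positive) radii `r` is a threshold for the sequence of properties `F`. -/
def IsThreshold {M : Type*} [MetricSpace M] [MeasurableSpace M] (μ : Measure M)
    (F : ∀ n : ℕ, Set (SimpleGraph (Fin n))) (r : ℕ → ℝ) : Prop :=
  (∀ n, 0 < r n) ∧
    ∀ s : ℕ → ℝ, (∀ n, 0 ≤ s n) →
      (Tendsto (fun n => s n / r n) atTop (𝓝 0) →
        Tendsto (fun n => prob μ (F n) (s n)) atTop (𝓝 0)) ∧
      (Tendsto (fun n => s n / r n) atTop atTop →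
        Tendsto (fun n => prob μ (F n) (s n)) atTop (𝓝 1))

/-- The metric probability space `(M, dist, μ)` admits thresholds: every sequence of nontrivial
monotone properties has a threshold.  There is only one graph on at most one vertex, hence no
nontrivial property, so the hypothesis is made for `n ≥ 2` (else it could never hold). -/
def AdmitsThresholds (M : Type*) [MetricSpace M] [MeasurableSpace M] [BorelSpace M]
    (μ : Measure M) [IsProbabilityMeasure μ] : Prop :=
  ∀ F : ∀ n : ℕ, Set (SimpleGraph (Fin n)),
    (∀ n, 2 ≤ n → IsNontrivialMonotone (F n)) → ∃ r : ℕ → ℝ, IsThreshold μ F r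

/-- The cube `[0,1]^d` as a subset of Euclidean space.  As a subtype it carries the Euclidean
metric. -/
def cube (d : ℕ) : Set (EuclideanSpace ℝ (Fin d)) :=
  {x | ∀ i, x i ∈ Set.Icc (0 : ℝ) 1}

theorem volume_cube (d : ℕ) : volume (cube d) = 1 := by
  have h : cube d = (WithLp.ofLp : EuclideanSpace ℝ (Fin d) → Fin d → ℝ) ⁻¹'
      (Set.univ.pi fun _ => Set.Icc (0 : ℝ) 1) := by
    ext x; simp [cube, Set.mem_pi, -Set.pi_univ_Icc]
  rw [h, (PiLp.volume_preserving_ofLp (Fin d)).measure_preimage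
    (MeasurableSet.univ_pi fun _ => measurableSet_Icc).nullMeasurableSet, volume_pi_pi]
  simp

theorem measurableSet_cube (d : ℕ) : MeasurableSet (cube d) := by
  have h : cube d = ⋂ i, {x : EuclideanSpace ℝ (Fin d) | x i ∈ Set.Icc (0 : ℝ) 1} := by
    ext x; simp [cube]
  rw [h]
  exact MeasurableSet.iInter fun i =>
    (by fun_prop : Measurable fun x : EuclideanSpace ℝ (Fin d) => x i) measurableSet_Icc

/-- Lebesgue measure on the cube. -/
def cubeMeasure (d : ℕ) : Measure (cube d) :=
  Measure.comap Subtype.val (volume : Measure (EuclideanSpace ℝ (Fin d)))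

instance isProbabilityMeasure_cubeMeasure (d : ℕ) : IsProbabilityMeasure (cubeMeasure d) where
  measure_univ := by
    rw [cubeMeasure, comap_subtype_coe_apply (measurableSet_cube d), Set.image_univ,
      Subtype.range_coe, volume_cube]

end RandomGeometricGraph

end

/-!
Call `p / (1 - p)` the odds of an event of probability `p`. The heart of the matter is that doubling
the radius at least doubles the odds of a monotone property `F`.

Identify the configurations of `n` points in the torus `(ℝ/ℤ)^d` with the points of `(ℝ/ℤ)^(n × d)`.
Let `D` be the event that the torus configuration has its graph of radius `r` in `F`, and `A` the
event that the configuration in the cube obtained from it by the folding `z ↦ 2 ‖z‖` of each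
coordinate has its graph of radius `2 r` in `F`. Folding preserves the measure and at most doubles
distances, so `D ⊆ A` and `A` has the probability of `F` at radius `2 r`. Gluing the opposite faces
of the cube preserves the measure and does not increase distances, so `D` is at least as likely as
`F` at radius `r`.

The indicator of `D` is invariant under all diagonal translations, hence its Fourier coefficients
vanish off the balanced frequencies `∑ i, k i = 0`. The indicator of `A` is even in every
coordinate. Reflecting a nonzero coordinate of a balanced frequency destroys the balance, so at most
half of the variance of the indicator of `A` is carried by balanced frequencies. By Cauchy–Schwarz,
`2 Cov(D, A)² ≤ Var(D) Var(A)`, and since `D ⊆ A` this says that the odds of `A` are at least twice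
those of `D`.

Consequently the odds grow by a factor `2 ^ k` when the radius is multiplied by `2 ^ k`, and the
radius at which the probability crosses `1 / 2` is a threshold.
-/

noncomputable section

namespace RandomGeometricGraph

open scoped ComplexConjugate ProbabilityTheory

section Series

variable {α : Type*}

theorem sq_norm_le_mul_of_hasSum_mul {𝕜 : Type*} [RCLike 𝕜] {u v : α → 𝕜} {s : 𝕜} {a b : ℝ}
    (huv : HasSum (fun k => u k * v k) s) (hu : HasSum (fun k => ‖u k‖ ^ 2) a)
    (hv : HasSum (fun k => ‖v k‖ ^ 2) b) : ‖s‖ ^ 2 ≤ a * b := by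
  refine le_of_tendsto_of_tendsto' (huv.norm.pow 2) (Tendsto.mul hu hv) fun t => ?_
  calc ‖∑ k ∈ t, u k * v k‖ ^ 2 ≤ (∑ k ∈ t, ‖u k‖ * ‖v k‖) ^ 2 := by
        gcongr
        exact (norm_sum_le _ _).trans_eq (by simp only [norm_mul])
    _ ≤ _ := Finset.sum_mul_sq_le_sq_mul_sq t _ _

theorem two_mul_tsum_indicator_le_tsum {w : α → ℝ} (hw : Summable w) (hw₀ : ∀ k, 0 ≤ w k)
    {σ : α → α} (hσ : σ.Involutive) (hwσ : ∀ k, w (σ k) = w k) {B : Set α}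
    (hB : ∀ k ∈ B, σ k ∈ B → w k = 0) : 2 * ∑' k, B.indicator w k ≤ ∑' k, w k := by
  have hsum : HasSum (B.indicator w) (∑' k, B.indicator w k) := (hw.indicator B).hasSum
  have hsumσ : HasSum (fun k => B.indicator w (σ k)) (∑' k, B.indicator w k) :=
    (Equiv.hasSum_iff hσ.toPerm).mpr hsum
  rw [two_mul]
  refine hasSum_le (fun k => ?_) (hsum.add hsumσ) hw.hasSum
  by_cases hk : k ∈ B <;> by_cases hσk : σ k ∈ B
  · simp [hk, hσk, hwσ, hB k hk hσk]
  all_goals simp [hk, hσk, hwσ, hw₀ k]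

end Series

section Reflection

variable {ι G : Type*} [DecidableEq ι]

/-- The reflection of a vector in the coordinate hyperplane `x i = 0`. It acts on points of the
torus as well as on frequencies. -/
def reflectAt [Neg G] (i : ι) (x : ι → G) : ι → G :=
  Function.update x i (-x i)

theorem reflectAt_apply [Neg G] (i : ι) (x : ι → G) (j : ι) :
    reflectAt i x j = if j = i then -x j else x j := by
  by_cases h : j = i
  · subst h; simp [reflectAt]
  · simp [reflectAt, h]

theorem neg_reflectAt [InvolutiveNeg G] (i : ι) (x : ι → G) :
    -reflectAt i x = reflectAt i (-x) := by
  ext j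
  by_cases h : j = i <;> simp [reflectAt_apply, h]

theorem reflectAt_involutive [InvolutiveNeg G] (i : ι) :
    Function.Involutive (reflectAt (G := G) i) := by
  intro x
  ext j
  by_cases h : j = i <;> simp [reflectAt_apply, h]

theorem reflectAt_zero [AddGroup G] (i : ι) : reflectAt i (0 : ι → G) = 0 := by
  ext j
  simp [reflectAt_apply]

theorem support_reflectAt [AddGroup G] (i : ι) (x : ι → G) :
    Function.support (reflectAt i x) = Function.support x := by
  ext j
  by_cases h : j = i <;> simp [reflectAt_apply, h]

theorem sum_reflectAt [Fintype ι] [AddCommGroup G] (i : ι) (x : ι → G) :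
    ∑ j, reflectAt i x j = ∑ j, x j - 2 • x i := by
  rw [reflectAt, Finset.sum_update_of_mem (Finset.mem_univ i),
    ← Finset.add_sum_erase _ _ (Finset.mem_univ i), Finset.sdiff_singleton_eq_erase]
  abel

theorem exists_involutive_reflectAt [AddGroup G] :
    ∃ σ : (ι → G) → ι → G, σ.Involutive ∧ σ 0 = 0 ∧
      ∀ k ≠ 0, ∃ i, k i ≠ 0 ∧ σ k = reflectAt i k := by
  rcases isEmpty_or_nonempty ι with _ | _
  · exact ⟨id, fun _ => rfl, rfl, fun k hk => absurd (Subsingleton.elim k 0) hk⟩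
  -- A reflection does not change the support, so choosing the coordinate through the support makes
  -- `σ` an involution.
  let pick (S : Set ι) : ι := Classical.epsilon (· ∈ S)
  refine ⟨fun k => reflectAt (pick k.support) k, fun k => ?_, reflectAt_zero _, fun k hk => ?_⟩
  · simp only [support_reflectAt, reflectAt_involutive (pick k.support) k]
  · exact ⟨pick k.support, Classical.epsilon_spec (Function.ne_iff.mp hk), rfl⟩

end Reflection

/-- The uniform probability measure on the torus `(ℝ/ℤ)^ι`. -/
def torusMeasure (ι : Type*) [Fintype ι] : Measure (UnitAddTorus ι) :=
  Measure.pi fun _ => AddCircle.haarAddCircle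

section Torus

variable {ι : Type*} [Fintype ι]

instance : IsProbabilityMeasure (torusMeasure ι) := by
  unfold torusMeasure; infer_instance

instance : (torusMeasure ι).IsAddHaarMeasure := by
  unfold torusMeasure; infer_instance

theorem measurePreserving_reflectAt [DecidableEq ι] (i : ι) :
    MeasurePreserving (reflectAt i) (torusMeasure ι) (torusMeasure ι) := by
  have h := measurePreserving_pi (fun _ : ι => (AddCircle.haarAddCircle : Measure UnitAddCircle))
    (fun _ : ι => AddCircle.haarAddCircle)
    (f := fun j z => if j = i then -z else z) (fun j => by
      by_cases h : j = i
      · simpa only [h, if_true] using! Measure.measurePreserving_neg AddCircle.haarAddCircle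
      · simpa only [h, if_false] using! MeasurePreserving.id AddCircle.haarAddCircle)
  exact (funext fun z => funext fun j => reflectAt_apply i z j :
    reflectAt (G := UnitAddCircle) i = _) ▸ h

theorem mFourier_reflectAt [DecidableEq ι] (i : ι) (k : ι → ℤ) (z : UnitAddTorus ι) :
    UnitAddTorus.mFourier (reflectAt i k) z = UnitAddTorus.mFourier k (reflectAt i z) := by
  refine Finset.prod_congr rfl fun j _ => ?_
  by_cases h : j = i <;> simp [reflectAt_apply, h, fourier_apply]

theorem fourier_sum {T : ℝ} {α : Type*} (s : Finset α) (k : α → ℤ) (x : AddCircle T) :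
    fourier (∑ i ∈ s, k i) x = ∏ i ∈ s, fourier (k i) x := by
  induction s using Finset.cons_induction with
  | empty => simp only [Finset.sum_empty, Finset.prod_empty, fourier_zero]
  | cons i s hi ih => rw [Finset.sum_cons, Finset.prod_cons, fourier_add, ih]

theorem mFourier_add_const (k : ι → ℤ) (z : UnitAddTorus ι) (a : UnitAddCircle) :
    UnitAddTorus.mFourier k (z + fun _ => a) =
      fourier (∑ i, k i) a * UnitAddTorus.mFourier k z := by
  simp only [UnitAddTorus.mFourier, ContinuousMap.coe_mk, Pi.add_apply, fourier_sum,
    ← Finset.prod_mul_distrib]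
  refine Finset.prod_congr rfl fun i _ => ?_
  simp only [fourier_apply, smul_add, AddCircle.toCircle_add, Circle.coe_mul, mul_comm]

section Coefficients

variable {E : Type*} [NormedAddCommGroup E] [NormedSpace ℂ E] {f : UnitAddTorus ι → E}

theorem mFourierCoeff_congr_ae {g : UnitAddTorus ι → E} (h : f =ᵐ[torusMeasure ι] g) :
    UnitAddTorus.mFourierCoeff f = UnitAddTorus.mFourierCoeff g :=
  funext fun _ => integral_congr_ae (h.mono fun z hz => by simp only [hz])

theorem mFourierCoeff_zero (f : UnitAddTorus ι → E) :
    UnitAddTorus.mFourierCoeff f 0 = ∫ z, f z ∂torusMeasure ι := by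
  simp only [UnitAddTorus.mFourierCoeff, neg_zero, UnitAddTorus.mFourier_zero,
    ContinuousMap.one_apply, one_smul]
  rfl

theorem mFourierCoeff_reflectAt [DecidableEq ι] {i : ι} (hf : ∀ z, f (reflectAt i z) = f z)
    (k : ι → ℤ) :
    UnitAddTorus.mFourierCoeff f (reflectAt i k) = UnitAddTorus.mFourierCoeff f k := by
  have hi := measurePreserving_reflectAt i
  calc ∫ z, UnitAddTorus.mFourier (-reflectAt i k) z • f z ∂torusMeasure ι
      = ∫ z, UnitAddTorus.mFourier (-k) (reflectAt i z) • f (reflectAt i z) ∂torusMeasure ι := by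
        simp only [neg_reflectAt, mFourier_reflectAt, hf]
    _ = ∫ z, UnitAddTorus.mFourier (-k) z • f z ∂torusMeasure ι :=
        hi.integral_comp
          (MeasurableEquiv.ofInvolutive _ (reflectAt_involutive i)
            hi.measurable).measurableEmbedding
          fun z => UnitAddTorus.mFourier (-k) z • f z

theorem mFourierCoeff_eq_zero_of_sum_ne_zero
    (hf : ∀ z (a : UnitAddCircle), f (z + fun _ => a) = f z) {k : ι → ℤ} (hk : ∑ i, k i ≠ 0) :
    UnitAddTorus.mFourierCoeff f k = 0 := by
  have hshift (a : UnitAddCircle) : UnitAddTorus.mFourierCoeff f k =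
      fourier (-∑ i, k i) a • UnitAddTorus.mFourierCoeff f k :=
    calc ∫ z, UnitAddTorus.mFourier (-k) z • f z ∂torusMeasure ι
        = ∫ z, UnitAddTorus.mFourier (-k) (z + fun _ => a) • f (z + fun _ => a) ∂torusMeasure ι :=
          (integral_add_right_eq_self (fun z => UnitAddTorus.mFourier (-k) z • f z) _).symm
      _ = fourier (-∑ i, k i) a • ∫ z, UnitAddTorus.mFourier (-k) z • f z ∂torusMeasure ι := by
          simp only [mFourier_add_const, hf, mul_smul, integral_smul, Pi.neg_apply,
            Finset.sum_neg_distrib]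
  have hhalf := fourier_add_half_inv_index (neg_ne_zero.mpr hk) one_pos (0 : UnitAddCircle)
  rw [zero_add, fourier_eval_zero] at hhalf
  have h := hshift ((1 / 2 / (-∑ i, k i : ℤ) : ℝ) : UnitAddCircle)
  rw [hhalf, neg_one_smul] at h
  have : IsAddTorsionFree E := .of_isTorsionFree ℂ E
  exact self_eq_neg.mp h

end Coefficients

section Parseval

variable {f g : UnitAddTorus ι → ℂ}

theorem hasSum_conj_mFourierCoeff_mul (hf : MemLp f 2 (torusMeasure ι))
    (hg : MemLp g 2 (torusMeasure ι)) :
    HasSum (fun k => conj (UnitAddTorus.mFourierCoeff f k) * UnitAddTorus.mFourierCoeff g k)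
      (∫ z, conj (f z) * g z ∂torusMeasure ι) := by
  have h : HasSum (fun k => conj (UnitAddTorus.mFourierCoeff (hf.toLp f) k) *
      UnitAddTorus.mFourierCoeff (hg.toLp g) k)
      (∫ z, conj (hf.toLp f z) * hg.toLp g z ∂torusMeasure ι) :=
    UnitAddTorus.hasSum_prod_mFourierCoeff (hf.toLp f) (hg.toLp g)
  rw [mFourierCoeff_congr_ae hf.coeFn_toLp, mFourierCoeff_congr_ae hg.coeFn_toLp] at h
  refine (integral_congr_ae ?_ : _ = ∫ z, conj (f z) * g z ∂torusMeasure ι) ▸ h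
  filter_upwards [hf.coeFn_toLp, hg.coeFn_toLp] with z hfz hgz
  rw [hfz, hgz]

theorem hasSum_sq_norm_mFourierCoeff (hf : MemLp f 2 (torusMeasure ι)) :
    HasSum (fun k => ‖UnitAddTorus.mFourierCoeff f k‖ ^ 2) (∫ z, ‖f z‖ ^ 2 ∂torusMeasure ι) := by
  have h : HasSum (fun k => ‖UnitAddTorus.mFourierCoeff (hf.toLp f) k‖ ^ 2)
      (∫ z, ‖hf.toLp f z‖ ^ 2 ∂torusMeasure ι) :=
    UnitAddTorus.hasSum_sq_mFourierCoeff (hf.toLp f)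
  rw [mFourierCoeff_congr_ae hf.coeFn_toLp] at h
  refine (integral_congr_ae ?_ : _ = ∫ z, ‖f z‖ ^ 2 ∂torusMeasure ι) ▸ h
  filter_upwards [hf.coeFn_toLp] with z hz
  rw [hz]

end Parseval

theorem two_mul_tsum_balanced_mFourierCoeff_le [DecidableEq ι] {g : UnitAddTorus ι → ℂ}
    (hg : MemLp g 2 (torusMeasure ι)) (hg₀ : ∫ z, g z ∂torusMeasure ι = 0)
    (hrefl : ∀ i z, g (reflectAt i z) = g z) :
    2 * ∑' k, {k : ι → ℤ | ∑ i, k i = 0}.indicator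
      (fun k => ‖UnitAddTorus.mFourierCoeff g k‖ ^ 2) k ≤ ∫ z, ‖g z‖ ^ 2 ∂torusMeasure ι := by
  obtain ⟨σ, hσ, hσ₀, hσrefl⟩ := exists_involutive_reflectAt (ι := ι) (G := ℤ)
  have hsum := hasSum_sq_norm_mFourierCoeff hg
  have hzero : UnitAddTorus.mFourierCoeff g 0 = 0 := by rw [mFourierCoeff_zero, hg₀]
  have hinv (k : ι → ℤ) : UnitAddTorus.mFourierCoeff g (σ k) = UnitAddTorus.mFourierCoeff g k := by
    by_cases hk : k = 0
    · rw [hk, hσ₀]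
    · obtain ⟨i, -, hi⟩ := hσrefl k hk
      rw [hi, mFourierCoeff_reflectAt (hrefl i)]
  rw [← hsum.tsum_eq]
  refine two_mul_tsum_indicator_le_tsum hsum.summable (fun k => by positivity) hσ
    (fun k => by rw [hinv]) fun k hk hσk => ?_
  by_cases hk₀ : k = 0
  · rw [hk₀, hzero, norm_zero, zero_pow two_ne_zero]
  · obtain ⟨i, hki, hi⟩ := hσrefl k hk₀
    have hbalance : ∑ j, k j - 2 • k i = 0 := by rw [← sum_reflectAt, ← hi]; exact hσk
    rw [show ∑ j, k j = 0 from hk, zero_sub, neg_eq_zero] at hbalance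
    exact absurd hbalance (smul_ne_zero two_ne_zero hki)

theorem two_mul_sq_norm_integral_conj_mul_le [DecidableEq ι] {f g : UnitAddTorus ι → ℂ}
    (hf : MemLp f 2 (torusMeasure ι)) (hg : MemLp g 2 (torusMeasure ι))
    (hg₀ : ∫ z, g z ∂torusMeasure ι = 0)
    (hshift : ∀ z (a : UnitAddCircle), f (z + fun _ => a) = f z)
    (hrefl : ∀ i z, g (reflectAt i z) = g z) :
    2 * ‖∫ z, conj (f z) * g z ∂torusMeasure ι‖ ^ 2 ≤
      (∫ z, ‖f z‖ ^ 2 ∂torusMeasure ι) * ∫ z, ‖g z‖ ^ 2 ∂torusMeasure ι := by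
  let B : Set (ι → ℤ) := {k | ∑ i, k i = 0}
  have hinner : HasSum (fun k => conj (UnitAddTorus.mFourierCoeff f k) *
      B.indicator (UnitAddTorus.mFourierCoeff g) k) (∫ z, conj (f z) * g z ∂torusMeasure ι) := by
    refine (hasSum_conj_mFourierCoeff_mul hf hg).congr_fun fun k => ?_
    by_cases hk : k ∈ B
    · rw [Set.indicator_of_mem hk]
    · rw [mFourierCoeff_eq_zero_of_sum_ne_zero hshift hk, map_zero, zero_mul, zero_mul]
  have hfsum : HasSum (fun k => ‖conj (UnitAddTorus.mFourierCoeff f k)‖ ^ 2)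
      (∫ z, ‖f z‖ ^ 2 ∂torusMeasure ι) := by
    simpa only [RCLike.norm_conj] using hasSum_sq_norm_mFourierCoeff hf
  have hgsum : HasSum (fun k => ‖B.indicator (UnitAddTorus.mFourierCoeff g) k‖ ^ 2)
      (∑' k, B.indicator (fun k => ‖UnitAddTorus.mFourierCoeff g k‖ ^ 2) k) := by
    refine ((hasSum_sq_norm_mFourierCoeff hg).summable.indicator B).hasSum.congr_fun fun k => ?_
    by_cases hk : k ∈ B <;> simp [hk]
  calc 2 * ‖∫ z, conj (f z) * g z ∂torusMeasure ι‖ ^ 2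
      ≤ 2 * ((∫ z, ‖f z‖ ^ 2 ∂torusMeasure ι) *
          ∑' k, B.indicator (fun k => ‖UnitAddTorus.mFourierCoeff g k‖ ^ 2) k) := by
        gcongr
        exact sq_norm_le_mul_of_hasSum_mul hinner hfsum hgsum
    _ = (∫ z, ‖f z‖ ^ 2 ∂torusMeasure ι) *
          (2 * ∑' k, B.indicator (fun k => ‖UnitAddTorus.mFourierCoeff g k‖ ^ 2) k) := by ring
    _ ≤ (∫ z, ‖f z‖ ^ 2 ∂torusMeasure ι) * ∫ z, ‖g z‖ ^ 2 ∂torusMeasure ι := by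
        gcongr
        exact two_mul_tsum_balanced_mFourierCoeff_le hg hg₀ hrefl

theorem two_mul_sq_covariance_le [DecidableEq ι] {f g : UnitAddTorus ι → ℝ}
    (hf : MemLp f 2 (torusMeasure ι)) (hg : MemLp g 2 (torusMeasure ι))
    (hshift : ∀ z (a : UnitAddCircle), f (z + fun _ => a) = f z)
    (hrefl : ∀ i z, g (reflectAt i z) = g z) :
    2 * cov[f, g; torusMeasure ι] ^ 2 ≤ Var[f; torusMeasure ι] * Var[g; torusMeasure ι] := by
  let c : ℝ := ∫ z, f z ∂torusMeasure ι
  let e : ℝ := ∫ z, g z ∂torusMeasure ι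
  have hg₀ : ∫ z, ((g z - e : ℝ) : ℂ) ∂torusMeasure ι = 0 := by
    rw [integral_complex_ofReal, integral_sub (hg.integrable one_le_two) (integrable_const e)]
    simp [e]
  have h := two_mul_sq_norm_integral_conj_mul_le (hf.sub (memLp_const c)).ofReal
    (hg.sub (memLp_const e)).ofReal hg₀ (fun z a => by simp [hshift])
    fun i z => by simp [hrefl]
  rw [ProbabilityTheory.variance_eq_integral hf.aemeasurable,
    ProbabilityTheory.variance_eq_integral hg.aemeasurable]
  simp only [RCLike.conj_ofReal, ← RCLike.ofReal_mul, integral_ofReal, RCLike.norm_ofReal, sq_abs,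
    Pi.sub_apply] at h
  exact h

end Torus

theorem covariance_indicator_one {Ω : Type*} [MeasurableSpace Ω] (μ : Measure Ω)
    [IsProbabilityMeasure μ] {S T : Set Ω} (hS : MeasurableSet S) (hT : MeasurableSet T) :
    cov[S.indicator 1, T.indicator 1; μ] = μ.real (S ∩ T) - μ.real S * μ.real T := by
  have hmem {U : Set Ω} (hU : MeasurableSet U) : MemLp (U.indicator (1 : Ω → ℝ)) 2 μ :=
    memLp_indicator_const 2 hU 1 (Or.inr (measure_ne_top μ U))
  rw [ProbabilityTheory.covariance_eq_sub (hmem hS) (hmem hT), ← Set.inter_indicator_one,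
    integral_indicator_one (hS.inter hT), integral_indicator_one hS, integral_indicator_one hT]

theorem two_mul_measureReal_mul_one_sub_le {ι : Type*} [Fintype ι] [DecidableEq ι]
    {D A : Set (UnitAddTorus ι)} (hD : MeasurableSet D) (hA : MeasurableSet A) (hDA : D ⊆ A)
    (hshift : ∀ z (a : UnitAddCircle), (z + fun _ => a) ∈ D ↔ z ∈ D)
    (hrefl : ∀ i z, reflectAt i z ∈ A ↔ z ∈ A) :
    2 * ((torusMeasure ι).real D * (1 - (torusMeasure ι).real A)) ≤
      (torusMeasure ι).real A * (1 - (torusMeasure ι).real D) := by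
  have hmem {U : Set (UnitAddTorus ι)} (hU : MeasurableSet U) :
      MemLp (U.indicator (1 : UnitAddTorus ι → ℝ)) 2 (torusMeasure ι) :=
    memLp_indicator_const 2 hU 1 (Or.inr (measure_ne_top _ U))
  have hcov := two_mul_sq_covariance_le (hmem hD) (hmem hA)
    (fun z a => Set.indicator_eq_indicator (hshift z a) rfl)
    fun i z => Set.indicator_eq_indicator (hrefl i z) rfl
  rw [← ProbabilityTheory.covariance_self (hmem hD).aemeasurable,
    ← ProbabilityTheory.covariance_self (hmem hA).aemeasurable,
    covariance_indicator_one _ hD hA, covariance_indicator_one _ hD hD,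
    covariance_indicator_one _ hA hA, Set.inter_self, Set.inter_self,
    Set.inter_eq_left.mpr hDA] at hcov
  have hq : 0 ≤ (torusMeasure ι).real D := measureReal_nonneg
  have hp : 0 ≤ (torusMeasure ι).real A := measureReal_nonneg
  have hq₁ : (torusMeasure ι).real D ≤ 1 := measureReal_le_one
  have hp₁ : (torusMeasure ι).real A ≤ 1 := measureReal_le_one
  set q := (torusMeasure ι).real D
  set p := (torusMeasure ι).real A
  rcases (mul_nonneg hq (sub_nonneg.mpr hp₁)).eq_or_lt with h₀ | hpos
  · rw [← h₀, mul_zero]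
    exact mul_nonneg hp (sub_nonneg.mpr hq₁)
  · refine le_of_mul_le_mul_right ?_ hpos
    linarith

section GeomGraph

variable {M : Type*} [MetricSpace M] {n : ℕ}

theorem geomGraph_le {N : Type*} [MetricSpace N] {x : Fin n → M} {y : Fin n → N} {r s : ℝ}
    (h : ∀ i j, dist (x i) (x j) ≤ r → dist (y i) (y j) ≤ s) :
    geomGraph x r ≤ geomGraph y s := fun i j hij => ⟨hij.1, h i j hij.2⟩

theorem eventually_geomGraph_eq_bot {x : Fin n → M} (hx : Function.Injective x) :
    ∀ᶠ r in 𝓝 0, geomGraph x r = ⊥ := by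
  have hdist : ∀ᶠ r in 𝓝 (0 : ℝ), ∀ i j, i ≠ j → r < dist (x i) (x j) := by
    simp only [eventually_all]
    exact fun i j hij => eventually_lt_nhds (dist_pos.mpr (hx.ne hij))
  filter_upwards [hdist] with r hr
  exact eq_bot_iff.mpr fun i j hij => absurd hij.2 (hr i j hij.1).not_ge

theorem eventually_geomGraph_eq_top (x : Fin n → M) : ∀ᶠ r in atTop, geomGraph x r = ⊤ := by
  have hdist : ∀ᶠ r in atTop, ∀ i j, dist (x i) (x j) ≤ r := by
    simp only [eventually_all]
    exact fun i j => eventually_ge_atTop _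
  filter_upwards [hdist] with r hr
  exact eq_top_iff.mpr fun i j hij => ⟨hij, hr i j⟩

theorem measurableSet_geomGraph_mem {Ω : Type*} [MeasurableSpace Ω] {x : Ω → Fin n → M}
    (hx : ∀ i j, Measurable fun ω => dist (x ω i) (x ω j)) (F : Set (SimpleGraph (Fin n)))
    (r : ℝ) : MeasurableSet {ω | geomGraph (x ω) r ∈ F} := by
  have heq (G : SimpleGraph (Fin n)) : MeasurableSet {ω | geomGraph (x ω) r = G} := by
    simp only [SimpleGraph.ext_iff, funext_iff, eq_iff_iff, Set.ofPred_forall]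
    exact .iInter fun i => .iInter fun j =>
      ((MeasurableSet.const (i ≠ j)).inter (measurableSet_le (hx i j) measurable_const)).iff
        (.const (G.Adj i j))
  have hunion : {ω | geomGraph (x ω) r ∈ F} = ⋃ G ∈ F, {ω | geomGraph (x ω) r = G} := by
    ext ω; simp
  rw [hunion]
  exact .biUnion F.to_countable fun G _ => heq G

end GeomGraph

section Monotone

variable {n : ℕ} {F : Set (SimpleGraph (Fin n))}

theorem IsNontrivialMonotone.isUpperSet (hF : IsNontrivialMonotone F) : IsUpperSet F :=
  fun G H hGH hG => hF.monotone G hG H hGH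

theorem IsNontrivialMonotone.top_mem (hF : IsNontrivialMonotone F) : ⊤ ∈ F := by
  obtain ⟨G, hG⟩ := Set.nonempty_iff_ne_empty.mpr hF.ne_empty
  exact hF.isUpperSet le_top hG

theorem IsNontrivialMonotone.bot_notMem (hF : IsNontrivialMonotone F) : ⊥ ∉ F := fun h =>
  hF.ne_univ (Set.eq_univ_of_forall fun _ => hF.isUpperSet bot_le h)

end Monotone

theorem pi_measure_eval_eq_eval_eq_zero {ι M : Type*} [Fintype ι] [MeasurableSpace M]
    [MeasurableEq M] (μ : Measure M) [IsProbabilityMeasure μ] [NullSingletonClass μ] {i j : ι}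
    (hij : i ≠ j) : (Measure.pi fun _ : ι => μ) {x | x i = x j} = 0 := by
  have hindep : ProbabilityTheory.IndepFun (fun x : ι → M => x i) (fun x => x j)
      (Measure.pi fun _ => μ) :=
    (ProbabilityTheory.iIndepFun_pi (μ := fun _ : ι => μ) (X := fun _ => id)
      fun _ => aemeasurable_id).indepFun hij
  have hmap := (ProbabilityTheory.indepFun_iff_map_prod_eq_prod_map_map
    (measurable_pi_apply i).aemeasurable (measurable_pi_apply j).aemeasurable).mp hindep
  rw [(measurePreserving_eval (fun _ : ι => μ) i).map_eq,
    (measurePreserving_eval (fun _ : ι => μ) j).map_eq] at hmap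
  calc (Measure.pi fun _ : ι => μ) {x | x i = x j} = (μ.prod μ) (Set.diagonal M) := by
        rw [← hmap, Measure.map_apply (by fun_prop) measurableSet_diagonal]
        rfl
    _ = 0 := by
        rw [Measure.measure_prod_null measurableSet_diagonal]
        refine .of_forall fun a => measure_mono_null (fun b hb => ?_) (measure_singleton a)
        exact Eq.symm hb

theorem ae_injective_pi {ι M : Type*} [Fintype ι] [MeasurableSpace M] [MeasurableEq M]
    (μ : Measure M) [IsProbabilityMeasure μ] [NullSingletonClass μ] :
    ∀ᵐ x ∂Measure.pi fun _ : ι => μ, Function.Injective x := by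
  have hne : ∀ᵐ x ∂Measure.pi fun _ : ι => μ, ∀ i j, i ≠ j → x i ≠ x j := by
    simp only [eventually_all]
    exact fun i j hij => measure_eq_zero_iff_ae_notMem.mp (pi_measure_eval_eq_eval_eq_zero μ hij)
  filter_upwards [hne] with x hx i j hij
  exact not_imp_not.mp (hx i j) hij

section Prob

variable {M : Type*} [MetricSpace M] [MeasurableSpace M] (μ : Measure M) [IsProbabilityMeasure μ]
  {n : ℕ} {F : Set (SimpleGraph (Fin n))}

theorem prob_mono (hF : IsUpperSet F) : Monotone (prob μ F) := fun _ _ hrs =>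
  measureReal_mono fun _ hx => hF (geomGraph_le fun _ _ h => h.trans hrs) hx

variable [BorelSpace M] [SecondCountableTopology M]

theorem tendsto_prob_of_ae_eventually_geomGraph_eq {l : Filter ℝ} [l.IsCountablyGenerated]
    {G : SimpleGraph (Fin n)}
    (hG : ∀ᵐ x ∂Measure.pi fun _ : Fin n => μ, ∀ᶠ r in l, geomGraph x r = G) :
    Tendsto (prob μ F) l (𝓝 (F.indicator 1 G)) := by
  have h := tendsto_measure_of_ae_tendsto_indicator_of_isFiniteMeasure
    (As := fun r => {x : Fin n → M | geomGraph x r ∈ F}) l (MeasurableSet.const (G ∈ F))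
    (measurableSet_geomGraph_mem (fun i j => by fun_prop) F)
    (hG.mono fun x hx => hx.mono fun r hr => by simp only [Set.mem_ofPred_eq, hr])
  have hreal := (ENNReal.tendsto_toReal (measure_ne_top _ _)).comp h
  by_cases hGF : G ∈ F <;> simpa [hGF] using! hreal

theorem tendsto_prob_zero [NullSingletonClass μ] (hF : IsNontrivialMonotone F) :
    Tendsto (prob μ F) (𝓝 0) (𝓝 0) := by
  have h := tendsto_prob_of_ae_eventually_geomGraph_eq μ (F := F)
    ((ae_injective_pi μ).mono fun _ => eventually_geomGraph_eq_bot)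
  rwa [Set.indicator_of_notMem hF.bot_notMem] at h

theorem tendsto_prob_atTop (hF : IsNontrivialMonotone F) : Tendsto (prob μ F) atTop (𝓝 1) := by
  have h := tendsto_prob_of_ae_eventually_geomGraph_eq μ (F := F)
    (.of_forall (eventually_geomGraph_eq_top (n := n)))
  rwa [Set.indicator_of_mem hF.top_mem] at h

end Prob

/-- A family of probabilities `p r` whose odds `p r / (1 - p r)` at least double whenever `r`
doubles. Clearing the denominators allows `p r = 1`. -/
structure DoublesOdds (p : ℝ → ℝ) : Prop where
  nonneg : ∀ r, 0 ≤ p r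
  le_one : ∀ r, p r ≤ 1
  two_mul_le : ∀ r, 2 * (p r * (1 - p (2 * r))) ≤ p (2 * r) * (1 - p r)

namespace DoublesOdds

variable {p : ℝ → ℝ}

theorem two_pow_mul_le (hp : DoublesOdds p) (r : ℝ) (k : ℕ) :
    2 ^ k * (p r * (1 - p (2 ^ k * r))) ≤ p (2 ^ k * r) * (1 - p r) := by
  induction k with
  | zero => simp
  | succ k ih =>
    have h := hp.two_mul_le (2 ^ k * r)
    rw [show 2 * (2 ^ k * r) = 2 ^ (k + 1) * r by ring] at h
    have ha := hp.nonneg r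
    have hb := hp.nonneg (2 ^ k * r)
    have hc := hp.nonneg (2 ^ (k + 1) * r)
    set a := p r
    set b := p (2 ^ k * r)
    set c := p (2 ^ (k + 1) * r)
    rcases hb.eq_or_lt with hb₀ | hb₀
    · have ha₀ : a = 0 := by
        rw [← hb₀, sub_zero, mul_one, zero_mul] at ih
        exact le_antisymm (nonpos_of_mul_nonpos_right ih (by positivity)) ha
      simpa [ha₀] using hc
    · refine le_of_mul_le_mul_right ?_ hb₀
      calc 2 ^ (k + 1) * (a * (1 - c)) * b = 2 ^ k * a * (2 * (b * (1 - c))) := by ring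
        _ ≤ 2 ^ k * a * (c * (1 - b)) := by gcongr
        _ = c * (2 ^ k * (a * (1 - b))) := by ring
        _ ≤ c * (b * (1 - a)) := by gcongr
        _ = c * (1 - a) * b := by ring

theorem le_half_pow (hp : DoublesOdds p) {r : ℝ} {k : ℕ} (h : p (2 ^ k * r) ≤ 1 / 2) :
    p r ≤ (1 / 2) ^ k := by
  have hr := hp.nonneg r
  rw [one_div_pow, le_div_iff₀' (by positivity)]
  suffices 2 ^ k * (p r * (1 / 2)) ≤ 1 / 2 * 1 by linarith
  calc 2 ^ k * (p r * (1 / 2)) ≤ 2 ^ k * (p r * (1 - p (2 ^ k * r))) := by gcongr; linarith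
    _ ≤ p (2 ^ k * r) * (1 - p r) := hp.two_pow_mul_le r k
    _ ≤ 1 / 2 * 1 := by gcongr; exacts [sub_nonneg.mpr (hp.le_one r), sub_le_self 1 hr]

theorem one_sub_le_half_pow (hp : DoublesOdds p) {r : ℝ} {k : ℕ} (h : 1 / 2 ≤ p r) :
    1 - p (2 ^ k * r) ≤ (1 / 2) ^ k := by
  have hk := sub_nonneg.mpr (hp.le_one (2 ^ k * r))
  rw [one_div_pow, le_div_iff₀' (by positivity)]
  suffices 2 ^ k * (1 / 2 * (1 - p (2 ^ k * r))) ≤ 1 * (1 / 2) by linarith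
  calc 2 ^ k * (1 / 2 * (1 - p (2 ^ k * r))) ≤ 2 ^ k * (p r * (1 - p (2 ^ k * r))) := by gcongr
    _ ≤ p (2 ^ k * r) * (1 - p r) := hp.two_pow_mul_le r k
    _ ≤ 1 * (1 / 2) := by gcongr; exacts [sub_nonneg.mpr (hp.le_one r), hp.le_one _, by linarith]

end DoublesOdds

/-- `ρ` is a radius at which `p` crosses the level `1 / 2`. Nothing is required of `p ρ` itself,
because `p` may jump there. -/
structure IsMedian (p : ℝ → ℝ) (ρ : ℝ) : Prop where
  lt_half : ∀ s < ρ, p s < 1 / 2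
  half_le : ∀ s > ρ, 1 / 2 ≤ p s

theorem exists_pos_isMedian {p : ℝ → ℝ} (hp : Monotone p) (h₀ : Tendsto p (𝓝 0) (𝓝 0))
    (h₁ : Tendsto p atTop (𝓝 1)) : ∃ ρ > 0, IsMedian p ρ := by
  obtain ⟨a, ha, ha₀⟩ : ∃ a, p a < 1 / 2 ∧ 0 < a :=
    ((h₀.mono_left nhdsWithin_le_nhds).eventually_lt_const one_half_pos |>.and
      self_mem_nhdsWithin : ∀ᶠ a in 𝓝[>] 0, p a < 1 / 2 ∧ 0 < a).exists
  obtain ⟨b, hb⟩ := (h₁.eventually_const_lt one_half_lt_one).exists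
  have hbdd : BddAbove {s | p s < 1 / 2} :=
    ⟨b, fun s hs => (hp.reflect_lt (lt_trans hs hb)).le⟩
  refine ⟨sSup {s | p s < 1 / 2}, ha₀.trans_le (le_csSup hbdd ha), fun s hs => ?_, fun s hs => ?_⟩
  · obtain ⟨t, ht, hst⟩ := exists_lt_of_lt_csSup ⟨a, ha⟩ hs
    exact (hp hst.le).trans_lt ht
  · exact not_lt.mp fun h => hs.not_ge (le_csSup hbdd h)

section Sequence

variable {p : ℕ → ℝ → ℝ} {ρ s : ℕ → ℝ}

theorem tendsto_zero_of_isMedian (hp : ∀ᶠ n in atTop, DoublesOdds (p n))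
    (hρ : ∀ᶠ n in atTop, IsMedian (p n) (ρ n)) (hρ₀ : ∀ n, 0 < ρ n)
    (hs : Tendsto (fun n => s n / ρ n) atTop (𝓝 0)) :
    Tendsto (fun n => p n (s n)) atTop (𝓝 0) := by
  refine tendsto_order.mpr ⟨fun a ha => hp.mono fun n hn => ha.trans_le (hn.nonneg _),
    fun ε hε => ?_⟩
  obtain ⟨k, hk⟩ := exists_pow_lt_of_lt_one hε one_half_lt_one
  filter_upwards [hp, hρ, hs.eventually_lt_const (by positivity : (0 : ℝ) < 1 / 2 ^ k)]
    with n hpn hρn hsn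
  have hlt : 2 ^ k * s n < ρ n := by
    rwa [div_lt_div_iff₀ (hρ₀ n) (by positivity), one_mul, mul_comm] at hsn
  exact (hpn.le_half_pow (hρn.lt_half _ hlt).le).trans_lt hk

theorem tendsto_one_of_isMedian (hp : ∀ᶠ n in atTop, DoublesOdds (p n))
    (hρ : ∀ᶠ n in atTop, IsMedian (p n) (ρ n)) (hρ₀ : ∀ n, 0 < ρ n)
    (hs : Tendsto (fun n => s n / ρ n) atTop atTop) :
    Tendsto (fun n => p n (s n)) atTop (𝓝 1) := by
  refine tendsto_order.mpr ⟨fun a ha => ?_,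
    fun a ha => hp.mono fun n hn => (hn.le_one _).trans_lt ha⟩
  obtain ⟨k, hk⟩ := exists_pow_lt_of_lt_one (sub_pos.mpr ha) one_half_lt_one
  filter_upwards [hp, hρ, hs.eventually_gt_atTop (2 ^ k)] with n hpn hρn hsn
  have hgt : ρ n < s n / 2 ^ k := by
    rwa [lt_div_iff₀ (hρ₀ n), mul_comm, ← lt_div_iff₀ (by positivity)] at hsn
  have h := hpn.one_sub_le_half_pow (k := k) (hρn.half_le _ hgt)
  rw [mul_div_cancel₀ _ (by positivity)] at h
  linarith

end Sequence

theorem admitsThresholds_of_doublesOdds {M : Type*} [MetricSpace M] [MeasurableSpace M]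
    [BorelSpace M] [SecondCountableTopology M] (μ : Measure M) [IsProbabilityMeasure μ]
    [NullSingletonClass μ]
    (h : ∀ (n : ℕ) (F : Set (SimpleGraph (Fin n))), IsUpperSet F → DoublesOdds (prob μ F)) :
    AdmitsThresholds M μ := by
  intro F hF
  have hmedian (n : ℕ) : ∃ ρ > 0, 2 ≤ n → IsMedian (prob μ (F n)) ρ := by
    by_cases hn : 2 ≤ n
    · obtain ⟨ρ, hρ₀, hρ⟩ := exists_pos_isMedian (prob_mono μ (hF n hn).isUpperSet)
        (tendsto_prob_zero μ (hF n hn)) (tendsto_prob_atTop μ (hF n hn))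
      exact ⟨ρ, hρ₀, fun _ => hρ⟩
    · exact ⟨1, one_pos, fun h => absurd h hn⟩
  choose ρ hρ₀ hρ using hmedian
  have hp : ∀ᶠ n in atTop, DoublesOdds (prob μ (F n)) :=
    (eventually_ge_atTop 2).mono fun n hn => h n (F n) (hF n hn).isUpperSet
  have hρ' : ∀ᶠ n in atTop, IsMedian (prob μ (F n)) (ρ n) := (eventually_ge_atTop 2).mono hρ
  exact ⟨ρ, hρ₀, fun s _ =>
    ⟨tendsto_zero_of_isMedian hp hρ' hρ₀, tendsto_one_of_isMedian hp hρ' hρ₀⟩⟩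

section CircleMeasure

theorem volume_unitAddCircle : (volume : Measure UnitAddCircle) = AddCircle.haarAddCircle := by
  rw [AddCircle.volume_eq_smul_haarAddCircle, ENNReal.ofReal_one, one_smul]

theorem measurePreserving_coe_unitAddCircle :
    MeasurePreserving ((↑) : ℝ → UnitAddCircle) (volume.restrict (Set.Icc 0 1))
      AddCircle.haarAddCircle := by
  have h := UnitAddCircle.measurePreserving_mk 0
  rwa [zero_add, volume_unitAddCircle, restrict_Ioc_eq_restrict_Icc] at h

theorem measurePreserving_two_mul_norm :
    MeasurePreserving (fun z : UnitAddCircle => 2 * ‖z‖) AddCircle.haarAddCircle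
      (volume.restrict (Set.Icc 0 1)) := by
  have hm : Measurable fun z : UnitAddCircle => 2 * ‖z‖ := by fun_prop
  have := Measure.isProbabilityMeasure_map (μ := AddCircle.haarAddCircle) hm.aemeasurable
  refine ⟨hm, Measure.ext_of_Iic _ _ fun t => ?_⟩
  have hball : (fun z : UnitAddCircle => 2 * ‖z‖) ⁻¹' Set.Iic t = Metric.closedBall 0 (t / 2) := by
    ext z
    rw [Set.mem_preimage, Set.mem_Iic, mem_closedBall_zero_iff, le_div_iff₀' zero_lt_two]
  have hIcc : Set.Iic t ∩ Set.Icc 0 1 = Set.Icc 0 (min 1 t) := by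
    ext z
    simp only [Set.mem_inter_iff, Set.mem_Iic, Set.mem_Icc, le_min_iff]
    tauto
  rw [Measure.map_apply hm measurableSet_Iic, Measure.restrict_apply measurableSet_Iic, hball, hIcc,
    ← volume_unitAddCircle, AddCircle.volume_closedBall, Real.volume_Icc, sub_zero,
    mul_div_cancel₀ _ two_ne_zero]

end CircleMeasure

theorem measurePreserving_uncurry_torusMeasure {α β : Type*} [Fintype α] [Fintype β] :
    MeasurePreserving (MeasurableEquiv.curry α β UnitAddCircle).symm
      (Measure.pi fun _ : α => torusMeasure β) (torusMeasure (α × β)) := by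
  refine ⟨MeasurableEquiv.measurable _, ?_⟩
  have h := Measure.infinitePi_map_curry_symm (ι := α) (κ := β)
    (fun _ _ => (AddCircle.haarAddCircle : Measure UnitAddCircle))
  simpa only [Measure.infinitePi_eq_pi] using! h

section Cube

variable {d n : ℕ}

/-- The configuration of `n` points in the `d`-dimensional torus, with its Euclidean metric, whose
coordinates are listed by `z`. -/
def torusConfig (z : UnitAddTorus (Fin n × Fin d)) (i : Fin n) :
    PiLp 2 fun _ : Fin d => UnitAddCircle :=
  WithLp.toLp 2 fun j => z (i, j)

/-- The folding of the torus onto the cube by `z ↦ 2 * ‖z‖` in each coordinate, where `‖z‖` is the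
distance of `z` to `0` in `ℝ/ℤ`. -/
def foldPoint (z : UnitAddTorus (Fin d)) : cube d :=
  ⟨WithLp.toLp 2 fun j => 2 * ‖z j‖, fun j => ⟨by positivity, by
    have h := AddCircle.norm_le_half_period 1 (x := z j) one_ne_zero
    rwa [abs_one, le_div_iff₀' zero_lt_two] at h⟩⟩

/-- The configuration in the cube obtained by folding each of the `n` points of the torus whose
coordinates are listed by `z`. -/
def foldConfig (z : UnitAddTorus (Fin n × Fin d)) (i : Fin n) : cube d :=
  foldPoint fun j => z (i, j)

/-- The coordinates in the torus of the image of a configuration in the cube under the quotient map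
`[0,1] → ℝ/ℤ`, which glues the opposite faces of the cube. -/
def wrapConfig (x : Fin n → cube d) : UnitAddTorus (Fin n × Fin d) :=
  fun ij => (((x ij.1 : EuclideanSpace ℝ (Fin d)) ij.2 : ℝ) : UnitAddCircle)

theorem measurableEmbedding_ofLp_cube :
    MeasurableEmbedding fun x : cube d => (x : EuclideanSpace ℝ (Fin d)).ofLp :=
  (MeasurableEquiv.toLp 2 (Fin d → ℝ)).symm.measurableEmbedding.comp
    (MeasurableEmbedding.subtype_coe (measurableSet_cube d))

theorem measurePreserving_ofLp_cube :
    MeasurePreserving (fun x : cube d => (x : EuclideanSpace ℝ (Fin d)).ofLp) (cubeMeasure d)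
      (Measure.pi fun _ => volume.restrict (Set.Icc 0 1)) := by
  have hval : MeasurePreserving (Subtype.val : cube d → _) (cubeMeasure d)
      (volume.restrict (cube d)) :=
    ⟨measurable_subtype_coe, map_comap_subtype_coe (measurableSet_cube d) _⟩
  have hofLp := (PiLp.volume_preserving_ofLp (Fin d)).restrict_preimage
    (MeasurableSet.univ_pi fun _ => measurableSet_Icc (a := (0 : ℝ)) (b := 1))
  have hcube : (WithLp.ofLp : EuclideanSpace ℝ (Fin d) → Fin d → ℝ) ⁻¹'
      (Set.univ.pi fun _ => Set.Icc (0 : ℝ) 1) = cube d := by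
    ext x; simp only [Set.mem_preimage, Set.mem_univ_pi]; rfl
  rw [hcube, volume_pi, Measure.restrict_pi_pi] at hofLp
  exact hofLp.comp hval

theorem measurePreserving_foldPoint :
    MeasurePreserving (foldPoint (d := d)) (torusMeasure (Fin d)) (cubeMeasure d) := by
  have hcoord := measurePreserving_pi (fun _ : Fin d => AddCircle.haarAddCircle)
    (fun _ : Fin d => volume.restrict (Set.Icc (0 : ℝ) 1)) fun _ => measurePreserving_two_mul_norm
  have hemb := measurableEmbedding_ofLp_cube (d := d)
  have hm : Measurable (foldPoint (d := d)) := hemb.measurable_comp_iff.mp hcoord.measurable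
  refine ⟨hm, ?_⟩
  rw [← hemb.comap_map (Measure.map _ _), ← hemb.comap_map (cubeMeasure d),
    Measure.map_map hemb.measurable hm, measurePreserving_ofLp_cube.map_eq]
  exact congrArg _ hcoord.map_eq

theorem measurePreserving_foldConfig :
    MeasurePreserving (foldConfig (n := n) (d := d)) (torusMeasure (Fin n × Fin d))
      (Measure.pi fun _ => cubeMeasure d) :=
  (measurePreserving_pi (fun _ : Fin n => torusMeasure (Fin d)) (fun _ => cubeMeasure d)
    fun _ => measurePreserving_foldPoint).comp
      (measurePreserving_uncurry_torusMeasure.symm _)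

theorem measurePreserving_wrapConfig :
    MeasurePreserving (wrapConfig (n := n) (d := d)) (Measure.pi fun _ => cubeMeasure d)
      (torusMeasure (Fin n × Fin d)) := by
  have hpoint := (measurePreserving_pi (fun _ : Fin d => volume.restrict (Set.Icc (0 : ℝ) 1))
    (fun _ => AddCircle.haarAddCircle) fun _ => measurePreserving_coe_unitAddCircle).comp
      measurePreserving_ofLp_cube
  exact measurePreserving_uncurry_torusMeasure.comp
    (measurePreserving_pi (fun _ : Fin n => cubeMeasure d) (fun _ => torusMeasure (Fin d))
      fun _ => hpoint)

theorem dist_torusConfig_wrapConfig_le (x : Fin n → cube d) (i j : Fin n) :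
    dist (torusConfig (wrapConfig x) i) (torusConfig (wrapConfig x) j) ≤ dist (x i) (x j) := by
  rw [Subtype.dist_eq, EuclideanSpace.dist_eq, PiLp.dist_eq_of_L2]
  gcongr with k
  simp only [torusConfig, wrapConfig, dist_eq_norm, ← AddCircle.coe_sub]
  exact QuotientAddGroup.norm_mk_le_norm

theorem dist_foldConfig_le (z : UnitAddTorus (Fin n × Fin d)) (i j : Fin n) :
    dist (foldConfig z i) (foldConfig z j) ≤ 2 * dist (torusConfig z i) (torusConfig z j) := by
  have hcoord (k : Fin d) : dist (2 * ‖z (i, k)‖) (2 * ‖z (j, k)‖) ≤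
      2 * dist (z (i, k)) (z (j, k)) := by
    rw [dist_eq_norm, dist_eq_norm, ← mul_sub, norm_mul, Real.norm_ofNat]
    exact mul_le_mul_of_nonneg_left (abs_norm_sub_norm_le _ _) zero_le_two
  calc dist (foldConfig z i) (foldConfig z j)
      = √(∑ k, dist (2 * ‖z (i, k)‖) (2 * ‖z (j, k)‖) ^ 2) := by
        rw [Subtype.dist_eq, EuclideanSpace.dist_eq]; rfl
    _ ≤ √(∑ k, (2 * dist (z (i, k)) (z (j, k))) ^ 2) := by gcongr; exact hcoord _
    _ = 2 * dist (torusConfig z i) (torusConfig z j) := by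
        simp only [mul_pow, ← Finset.mul_sum, Real.sqrt_mul (sq_nonneg (2 : ℝ)),
          Real.sqrt_sq zero_le_two, PiLp.dist_eq_of_L2, torusConfig]

theorem geomGraph_torusConfig_add_const (z : UnitAddTorus (Fin n × Fin d)) (a : UnitAddCircle)
    (r : ℝ) : geomGraph (torusConfig (z + fun _ => a)) r = geomGraph (torusConfig z) r := by
  ext i j
  simp only [geomGraph, PiLp.dist_eq_of_L2, torusConfig, Pi.add_apply, dist_add_right]

theorem foldConfig_reflectAt (ij : Fin n × Fin d) (z : UnitAddTorus (Fin n × Fin d)) :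
    foldConfig (reflectAt ij z) = foldConfig z := by
  funext i
  refine Subtype.ext (PiLp.ext fun j => ?_)
  change 2 * ‖reflectAt ij z (i, j)‖ = 2 * ‖z (i, j)‖
  by_cases h : (i, j) = ij <;> simp [reflectAt_apply, h]

theorem measurableSet_geomGraph_torusConfig_mem (F : Set (SimpleGraph (Fin n))) (r : ℝ) :
    MeasurableSet {z : UnitAddTorus (Fin n × Fin d) | geomGraph (torusConfig z) r ∈ F} :=
  measurableSet_geomGraph_mem
    (fun i j => by simp only [PiLp.dist_eq_of_L2, torusConfig]; fun_prop) F r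

theorem measurableSet_geomGraph_cube_mem (F : Set (SimpleGraph (Fin n))) (r : ℝ) :
    MeasurableSet {x : Fin n → cube d | geomGraph x r ∈ F} :=
  measurableSet_geomGraph_mem (fun i j => by fun_prop) F r

theorem prob_cubeMeasure_eq_measureReal_foldConfig (F : Set (SimpleGraph (Fin n))) (r : ℝ) :
    prob (cubeMeasure d) F r =
      (torusMeasure (Fin n × Fin d)).real {z | geomGraph (foldConfig z) r ∈ F} :=
  (measurePreserving_foldConfig.measureReal_preimage
    (measurableSet_geomGraph_cube_mem F r).nullMeasurableSet).symm

theorem prob_cubeMeasure_le_measureReal_torusConfig {F : Set (SimpleGraph (Fin n))}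
    (hF : IsUpperSet F) (r : ℝ) :
    prob (cubeMeasure d) F r ≤
      (torusMeasure (Fin n × Fin d)).real {z | geomGraph (torusConfig z) r ∈ F} := by
  rw [← measurePreserving_wrapConfig.measureReal_preimage
    (measurableSet_geomGraph_torusConfig_mem F r).nullMeasurableSet]
  exact measureReal_mono fun x hx =>
    hF (geomGraph_le fun i j h => (dist_torusConfig_wrapConfig_le x i j).trans h) hx

theorem two_mul_prob_cubeMeasure_mul_one_sub_le {F : Set (SimpleGraph (Fin n))} (hF : IsUpperSet F)
    (r : ℝ) : 2 * (prob (cubeMeasure d) F r * (1 - prob (cubeMeasure d) F (2 * r))) ≤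
      prob (cubeMeasure d) F (2 * r) * (1 - prob (cubeMeasure d) F r) := by
  let D : Set (UnitAddTorus (Fin n × Fin d)) := {z | geomGraph (torusConfig z) r ∈ F}
  let A : Set (UnitAddTorus (Fin n × Fin d)) := {z | geomGraph (foldConfig z) (2 * r) ∈ F}
  have hA : MeasurableSet A :=
    measurePreserving_foldConfig.measurable (measurableSet_geomGraph_cube_mem F (2 * r))
  have hDA : D ⊆ A := fun z hz => hF (geomGraph_le fun i j h =>
    (dist_foldConfig_le z i j).trans (mul_le_mul_of_nonneg_left h zero_le_two)) hz
  have hodds := two_mul_measureReal_mul_one_sub_le (measurableSet_geomGraph_torusConfig_mem F r) hA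
    hDA (fun z a => by simp only [Set.mem_ofPred_eq, geomGraph_torusConfig_add_const])
    fun ij z => by simp only [A, Set.mem_ofPred_eq, foldConfig_reflectAt]
  have hprobD := prob_cubeMeasure_le_measureReal_torusConfig (d := d) hF r
  rw [prob_cubeMeasure_eq_measureReal_foldConfig F (2 * r)]
  have hA₁ : 0 ≤ 1 - (torusMeasure (Fin n × Fin d)).real A := sub_nonneg.mpr measureReal_le_one
  calc 2 * (prob (cubeMeasure d) F r * (1 - (torusMeasure (Fin n × Fin d)).real A))
      ≤ 2 * ((torusMeasure (Fin n × Fin d)).real D *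
          (1 - (torusMeasure (Fin n × Fin d)).real A)) := by gcongr
    _ ≤ (torusMeasure (Fin n × Fin d)).real A * (1 - (torusMeasure (Fin n × Fin d)).real D) := hodds
    _ ≤ (torusMeasure (Fin n × Fin d)).real A * (1 - prob (cubeMeasure d) F r) := by gcongr

theorem doublesOdds_prob_cubeMeasure {F : Set (SimpleGraph (Fin n))} (hF : IsUpperSet F) :
    DoublesOdds (prob (cubeMeasure d) F) where
  nonneg _ := measureReal_nonneg
  le_one _ := measureReal_le_one
  two_mul_le := two_mul_prob_cubeMeasure_mul_one_sub_le hF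

theorem nullSingletonClass_cubeMeasure (hd : 1 ≤ d) : NullSingletonClass (cubeMeasure d) where
  measure_singleton x := by
    have : Nonempty (Fin d) := ⟨⟨0, hd⟩⟩
    rw [cubeMeasure, comap_subtype_coe_apply (measurableSet_cube d), Set.image_singleton,
      measure_singleton]

end Cube

end RandomGeometricGraph

end

theorem mainTheorem4 (d : ℕ) (hd : 1 ≤ d) :
    RandomGeometricGraph.AdmitsThresholds (RandomGeometricGraph.cube d)
      (RandomGeometricGraph.cubeMeasure d) :=
  have := RandomGeometricGraph.nullSingletonClass_cubeMeasure hd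
  RandomGeometricGraph.admitsThresholds_of_doublesOdds _ fun _ _ =>
    RandomGeometricGraph.doublesOdds_prob_cubeMeasure
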